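/- For $\alpha\in[0,\pi]$ let $$U_{\rm PS}(\alpha)=\cos\left(\tfrac{\alpha}{2}\right)\mathrm{id}+\mathrm{i}\sin\left(\tfrac{\alpha}{2}\right)U_{\rm SWAP}$$ be the partial SWAP gate on two qubits $\mathbf{E}\otimes\mathbf{A}$, where $U_{\rm SWAP}|ij\rangle=|ji\rangle$. For qubit density matrices $\rho_A=(\rho_0,\rho_1)$ of $\mathbf{A}$ and a two-outcome qubit POVM $F_B=(F_0,F_1)$ let $$G^{\alpha}_{B=b\mid A=a}=\mathrm{Tr}_{\mathbf{A}}\left[U_{\rm PS}(\alpha)^\dagger(\mathrm{id}\otimes F_b)\,U_{\rm PS}(\alpha)(\mathrm{id}\otimes\rho_a)\right],\qquad a,b\in\{0,1\},$$ a POVM assemblage on the qubit $\mathbf{E}$ (for each $a$, a POVM with outcomes $b$). Call such an assemblage jointly measurable if there are a finite POVM $(H_\lambda)_\lambda$ on $\mathbf{E}$ and conditional probabilities $h(b\mid a,\lambda)$ with $G^{\alpha}_{B=b\mid A=a}=\sum_\lambda h(b\mid a,\lambda)H_\lambda$ for all $a,b$, and incompatible if it is not jointly measurable. 1. If $0\le\alpha\le\pi/2$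 or $\alpha=\pi$, then $G^{\alpha}_{B\mid A}$ is jointly measurable for all choices of states $\rho_0,\rho_1$ and of the POVM $(F_0,F_1)$. 2. For every $\alpha$ with $\pi/2<\alpha<\pi$ there are states $\rho_0,\rho_1$ and a POVM $(F_0,F_1)$ for which $G^{\alpha}_{B\mid A}$ is incompatible. -/

import Mathlib

open scoped Kronecker ComplexOrder

noncomputable section

/-- A density matrix: positive semidefinite with unit trace. -/
def IsDensityMatrix {d : Type*} [Fintype d] (ρ : Matrix d d ℂ) : Prop :=
  ρ.PosSemidef ∧ ρ.trace = 1

/-- A POVM with finitely many outcomes `o`: positive semidefinite effects summing to the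
identity. -/
def IsPOVM {o d : Type*} [Fintype o] [Fintype d] [DecidableEq d]
    (F : o → Matrix d d ℂ) : Prop :=
  (∀ b, (F b).PosSemidef) ∧ ∑ b, F b = 1

/-- A POVM assemblage `G a b`: for every setting `a`, a POVM with outcome `b`. -/
def IsPOVMAssemblage {x o d : Type*} [Fintype o] [Fintype d] [DecidableEq d]
    (G : x → o → Matrix d d ℂ) : Prop :=
  ∀ a, IsPOVM (G a)

/-- A classical channel (conditional distribution) `h a l b`, the probability of the output `b`
given the inputs `a` and `l`. -/
def IsClassicalChannel {x o L : Type*} [Fintype o] (h : x → L → o → ℝ) : Prop :=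
  (∀ a l b, 0 ≤ h a l b) ∧ ∀ a l, ∑ b, h a l b = 1

/-- Joint measurability: the assemblage arises from a single (finite) POVM `H` followed by
classical post-processing `h`. -/
def IsJointlyMeasurable {x o d : Type*} [Fintype o] [Fintype d] [DecidableEq d]
    (G : x → o → Matrix d d ℂ) : Prop :=
  ∃ (k : ℕ) (H : Fin k → Matrix d d ℂ) (h : x → Fin k → o → ℝ),
    IsPOVM H ∧ IsClassicalChannel h ∧
      ∀ a b, G a b = ∑ l, ((h a l b : ℝ) : ℂ) • H l

/-- An incompatible assemblage: a POVM assemblage that is not jointly measurable. -/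
def IsIncompatible {x o d : Type*} [Fintype o] [Fintype d] [DecidableEq d]
    (G : x → o → Matrix d d ℂ) : Prop :=
  IsPOVMAssemblage G ∧ ¬ IsJointlyMeasurable G

/-- Partial trace over the second tensor factor. -/
def partialTraceSnd {e s : Type*} [Fintype s] (M : Matrix (e × s) (e × s) ℂ) : Matrix e e ℂ :=
  Matrix.of fun i j => ∑ k, M (i, k) (j, k)

/-- The two-qubit SWAP unitary, `|i j⟩ ↦ |j i⟩`. -/
def swapGate : Matrix (Fin 2 × Fin 2) (Fin 2 × Fin 2) ℂ :=
  Matrix.of fun p q => if p = q.swap then 1 else 0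

/-- The partial SWAP gate `cos (α/2) id + i sin (α/2) SWAP`. -/
def partialSwap (α : ℝ) : Matrix (Fin 2 × Fin 2) (Fin 2 × Fin 2) ℂ :=
  ((Real.cos (α / 2) : ℝ) : ℂ) • (1 : Matrix (Fin 2 × Fin 2) (Fin 2 × Fin 2) ℂ) +
    (Complex.I * ((Real.sin (α / 2) : ℝ) : ℂ)) • swapGate

/-- The family `G a b = Tr_A [Uᴴ (1 ⊗ F b) U (1 ⊗ ρ a)]` on the memory `E`: prepare `A` in the
state `ρ a`, let it interact with `E` through `U`, and measure the outgoing system `B` with the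
POVM `F`. The first tensor factor is `E` (outgoing `E'`), the second one `A` (outgoing `B`). -/
def inducedAssemblage {e s x o : Type*} [Fintype e] [DecidableEq e] [Fintype s] [DecidableEq s]
    (U : Matrix (e × s) (e × s) ℂ) (ρ : x → Matrix s s ℂ) (F : o → Matrix s s ℂ) :
    x → o → Matrix e e ℂ :=
  fun a b => partialTraceSnd
    (U.conjTranspose * ((1 : Matrix e e ℂ) ⊗ₖ F b) * U * ((1 : Matrix e e ℂ) ⊗ₖ ρ a))

end

/-! In Pauli coordinates positive matrices form the light cone and the determinant is the Lorentz
square. Write `c = cos (α/2)` and `s = sin (α/2)`. Two binary observables with first effects `A`,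
`B` are compatible once `B = J + J'` with `0 ≤ J ≤ A` and `0 ≤ J' ≤ 1 - A`. By Hahn-Banach this
reduces to comparing support functions (`exists_add_eq_of_lorentzSq_ge`). The support function of
`[0, A]` depends on `det A`, and the induced effects have determinant at least `c² Tr(F ρ)²`
(`lorentzSq_inducedCoord_ge`). A triangle inequality then bounds the support function of the sum
from below in terms of `c²`. Every induced `B` obeys the matching upper bound with `s²`
(`two_mul_pair4_inducedCoord_le`), so `s² ≤ c²` suffices. At `α = π` the state of `A` has no
influence. For `0 < c < s`, a CHSH-type inequality (`IsJointlyMeasurable.pauli_le`) is violated. -/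

noncomputable section

/-! ### Pauli coordinates of Hermitian 2 × 2 matrices. -/

open Complex in
/-- The Hermitian matrix with Pauli coordinates `e`. -/
def pauliMatrix (e : Fin 4 → ℝ) : Matrix (Fin 2) (Fin 2) ℂ :=
  !![(e 0 : ℂ) + e 3, e 1 - I * e 2; e 1 + I * e 2, e 0 - e 3]

/-- The forward light cone, the Pauli coordinates of positive semidefinite matrices. -/
def lightCone : Set (Fin 4 → ℝ) :=
  {e | 0 ≤ e 0 ∧ e 1 ^ 2 + e 2 ^ 2 + e 3 ^ 2 ≤ e 0 ^ 2}

/-- The Lorentz square, the determinant of `pauliMatrix e`. -/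
def lorentzSq (e : Fin 4 → ℝ) : ℝ := e 0 ^ 2 - e 1 ^ 2 - e 2 ^ 2 - e 3 ^ 2

/-- The Euclidean pairing of Pauli coordinates. -/
def pair4 (w e : Fin 4 → ℝ) : ℝ := w 0 * e 0 + w 1 * e 1 + w 2 * e 2 + w 3 * e 3

/-- The Pauli coordinates of the identity matrix. -/
def unitCoord : Fin 4 → ℝ := ![1, 0, 0, 0]

theorem pauliMatrix_add (e f : Fin 4 → ℝ) :
    pauliMatrix (e + f) = pauliMatrix e + pauliMatrix f := by
  ext i j
  fin_cases i <;> fin_cases j <;> simp [pauliMatrix] <;> ring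

theorem pauliMatrix_sub (e f : Fin 4 → ℝ) :
    pauliMatrix (e - f) = pauliMatrix e - pauliMatrix f := by
  ext i j
  fin_cases i <;> fin_cases j <;> simp [pauliMatrix] <;> ring

theorem pauliMatrix_unitCoord : pauliMatrix unitCoord = 1 := by
  ext i j
  fin_cases i <;> fin_cases j <;> simp [pauliMatrix, unitCoord]

theorem pauliMatrix_injective : Function.Injective pauliMatrix := by
  intro e f h
  have h00 := congrArg Complex.re (congrFun (congrFun h 0) 0)
  have h11 := congrArg Complex.re (congrFun (congrFun h 1) 1)
  have h10 := congrArg Complex.re (congrFun (congrFun h 1) 0)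
  have h10' := congrArg Complex.im (congrFun (congrFun h 1) 0)
  simp [pauliMatrix] at h00 h11 h10 h10'
  ext i
  fin_cases i <;> simp <;> linarith

theorem exists_pauliMatrix {M : Matrix (Fin 2) (Fin 2) ℂ} (hM : M.IsHermitian) :
    ∃ e, M = pauliMatrix e := by
  have h00 := congrArg Complex.im (hM.apply 0 0)
  have h11 := congrArg Complex.im (hM.apply 1 1)
  have h10 := congrArg Complex.re (hM.apply 0 1)
  have h10' := congrArg Complex.im (hM.apply 0 1)
  simp at h00 h11 h10 h10'
  refine ⟨![((M 0 0).re + (M 1 1).re) / 2, (M 1 0).re, (M 1 0).im,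
    ((M 0 0).re - (M 1 1).re) / 2], ?_⟩
  ext i j
  fin_cases i <;> fin_cases j <;> apply Complex.ext <;> simp [pauliMatrix] <;> linarith

theorem pauliMatrix_posSemidef_iff (e : Fin 4 → ℝ) :
    (pauliMatrix e).PosSemidef ↔ e ∈ lightCone := by
  have herm : (pauliMatrix e).IsHermitian := by
    ext i j
    fin_cases i <;> fin_cases j <;> apply Complex.ext <;> simp [pauliMatrix]
  constructor
  · intro h
    have hdet := h.det_nonneg
    have htr := h.trace_nonneg
    rw [Complex.le_def] at hdet htr
    simp [pauliMatrix, Matrix.det_fin_two, Matrix.trace_fin_two] at hdet htr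
    exact ⟨by linarith, by nlinarith⟩
  · rintro ⟨h0, h1⟩
    refine Matrix.PosSemidef.of_dotProduct_mulVec_nonneg herm fun x => ?_
    rw [Complex.le_def]
    have hre : (star x ⬝ᵥ Matrix.mulVec (pauliMatrix e) x).re =
        e 0 * ((x 0).re ^ 2 + (x 0).im ^ 2 + (x 1).re ^ 2 + (x 1).im ^ 2)
        + (e 1 * (2 * ((x 0).re * (x 1).re + (x 0).im * (x 1).im))
        + e 2 * (2 * ((x 0).re * (x 1).im - (x 0).im * (x 1).re))
        + e 3 * ((x 0).re ^ 2 + (x 0).im ^ 2 - (x 1).re ^ 2 - (x 1).im ^ 2)) := by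
      simp [pauliMatrix, Matrix.mulVec, dotProduct, Fin.sum_univ_two]
      ring
    refine ⟨?_, ?_⟩
    · rw [hre]
      set N := (x 0).re ^ 2 + (x 0).im ^ 2 + (x 1).re ^ 2 + (x 1).im ^ 2 with hN
      set p := 2 * ((x 0).re * (x 1).re + (x 0).im * (x 1).im) with hp
      set q := 2 * ((x 0).re * (x 1).im - (x 0).im * (x 1).re) with hq
      set r := (x 0).re ^ 2 + (x 0).im ^ 2 - (x 1).re ^ 2 - (x 1).im ^ 2 with hr
      have hNn : 0 ≤ N := by positivity
      -- `(N, p, q, r)` is twice the Pauli vector of the rank-one matrix `x xᴴ`, hence null.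
      have hs : p ^ 2 + q ^ 2 + r ^ 2 = N ^ 2 := by rw [hN, hp, hq, hr]; ring
      have hc : (e 1 * p + e 2 * q + e 3 * r) ^ 2 ≤ (e 0 * N) ^ 2 := by
        have : (e 1 * p + e 2 * q + e 3 * r) ^ 2 ≤
            (e 1 ^ 2 + e 2 ^ 2 + e 3 ^ 2) * (p ^ 2 + q ^ 2 + r ^ 2) := by
          nlinarith [sq_nonneg (e 1 * q - e 2 * p), sq_nonneg (e 1 * r - e 3 * p),
            sq_nonneg (e 2 * r - e 3 * q)]
        rw [hs] at this
        nlinarith [sq_nonneg N]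
      have := (abs_le_of_sq_le_sq' hc (by positivity)).1
      simp only [Complex.zero_re]
      linarith
    · simp [pauliMatrix, Matrix.mulVec, dotProduct, Fin.sum_univ_two]
      ring

/-! ### The induced assemblage in Pauli coordinates. -/

theorem inducedAssemblage_partialSwap (α : ℝ) {x o : Type*}
    (ρ : x → Matrix (Fin 2) (Fin 2) ℂ) (F : o → Matrix (Fin 2) (Fin 2) ℂ) (a : x) (b : o) :
    inducedAssemblage (partialSwap α) ρ F a b =
      (((Real.cos (α / 2) : ℝ) : ℂ) ^ 2 * (F b * ρ a).trace) • 1 +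
      (((Real.sin (α / 2) : ℝ) : ℂ) ^ 2 * (ρ a).trace) • F b +
      (Complex.I * ((Real.cos (α / 2) : ℝ) : ℂ) * ((Real.sin (α / 2) : ℝ) : ℂ)) •
        (ρ a * F b - F b * ρ a) := by
  simp only [inducedAssemblage, partialSwap]
  generalize Real.cos (α / 2) = c
  generalize Real.sin (α / 2) = s
  generalize F b = F
  generalize ρ a = ρ
  have hI : Complex.I ^ 2 = -1 := Complex.I_sq
  ext i j
  fin_cases i <;> fin_cases j <;>
    simp [partialTraceSnd, swapGate, Matrix.mul_apply, Matrix.one_apply,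
      Fintype.sum_prod_type, Fin.sum_univ_two, Matrix.trace_fin_two, Matrix.conjTranspose_apply] <;>
    ring_nf <;> simp only [hI] <;> ring

/-- The Pauli coordinates of the effect induced by a partial swap with coefficients `c` and `s`
from the effect and the state with Pauli coordinates `f` and `r`. -/
def inducedCoord (c s : ℝ) (r f : Fin 4 → ℝ) : Fin 4 → ℝ :=
  ![c ^ 2 * (f 0 + 2 * (f 1 * r 1 + f 2 * r 2 + f 3 * r 3)) + s ^ 2 * f 0,
    s ^ 2 * f 1 - 2 * c * s * (r 2 * f 3 - r 3 * f 2),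
    s ^ 2 * f 2 - 2 * c * s * (r 3 * f 1 - r 1 * f 3),
    s ^ 2 * f 3 - 2 * c * s * (r 1 * f 2 - r 2 * f 1)]

theorem inducedAssemblage_eq_pauliMatrix (α : ℝ) {x o : Type*}
    {ρ : x → Matrix (Fin 2) (Fin 2) ℂ} {F : o → Matrix (Fin 2) (Fin 2) ℂ} {a : x} {b : o}
    {r f : Fin 4 → ℝ} (hr : ρ a = pauliMatrix r) (hr0 : r 0 = 1 / 2) (hf : F b = pauliMatrix f) :
    inducedAssemblage (partialSwap α) ρ F a b =
      pauliMatrix (inducedCoord (Real.cos (α / 2)) (Real.sin (α / 2)) r f) := by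
  rw [inducedAssemblage_partialSwap, hr, hf]
  generalize Real.cos (α / 2) = c
  generalize Real.sin (α / 2) = s
  ext i j
  fin_cases i <;> fin_cases j <;> apply Complex.ext <;>
    simp [pauliMatrix, inducedCoord, Matrix.trace_fin_two,
      hr0, ← Complex.ofReal_pow] <;>
    ring

/-! ### Geometry of the light cone and its order intervals. -/

theorem mul_add_mul_add_mul_le {a₁ a₂ a₃ b₁ b₂ b₃ M N : ℝ} (hM : 0 ≤ M) (hN : 0 ≤ N)
    (ha : a₁ ^ 2 + a₂ ^ 2 + a₃ ^ 2 ≤ M ^ 2) (hb : b₁ ^ 2 + b₂ ^ 2 + b₃ ^ 2 ≤ N ^ 2) :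
    a₁ * b₁ + a₂ * b₂ + a₃ * b₃ ≤ M * N := by
  refine (abs_le_of_sq_le_sq' ?_ (mul_nonneg hM hN)).2
  calc (a₁ * b₁ + a₂ * b₂ + a₃ * b₃) ^ 2
      ≤ (a₁ ^ 2 + a₂ ^ 2 + a₃ ^ 2) * (b₁ ^ 2 + b₂ ^ 2 + b₃ ^ 2) := by
        nlinarith [sq_nonneg (a₁ * b₂ - a₂ * b₁), sq_nonneg (a₁ * b₃ - a₃ * b₁),
          sq_nonneg (a₂ * b₃ - a₃ * b₂)]
    _ ≤ M ^ 2 * N ^ 2 := mul_le_mul ha hb (by positivity) (by positivity)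
    _ = (M * N) ^ 2 := by ring

theorem lightCone_add {e f : Fin 4 → ℝ} (he : e ∈ lightCone) (hf : f ∈ lightCone) :
    e + f ∈ lightCone := by
  refine ⟨add_nonneg he.1 hf.1, ?_⟩
  have := mul_add_mul_add_mul_le he.1 hf.1 he.2 hf.2
  simp only [Pi.add_apply]
  nlinarith [he.2, hf.2]

theorem lightCone_smul {e : Fin 4 → ℝ} (he : e ∈ lightCone) {c : ℝ} (hc : 0 ≤ c) :
    c • e ∈ lightCone := by
  refine ⟨mul_nonneg hc he.1, ?_⟩
  simp only [Pi.smul_apply, smul_eq_mul]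
  nlinarith [mul_le_mul_of_nonneg_left he.2 (sq_nonneg c)]

theorem zero_mem_lightCone : (0 : Fin 4 → ℝ) ∈ lightCone := by
  simp [lightCone]

theorem convex_lightCone : Convex ℝ lightCone := fun _ he _ hf _ _ ha hb _ =>
  lightCone_add (lightCone_smul he ha) (lightCone_smul hf hb)

theorem isClosed_lightCone : IsClosed lightCone := by
  have h : lightCone = {e : Fin 4 → ℝ | 0 ≤ e 0} ∩
      {e : Fin 4 → ℝ | e 1 ^ 2 + e 2 ^ 2 + e 3 ^ 2 ≤ e 0 ^ 2} := rfl
  rw [h]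
  exact (isClosed_le (by fun_prop) (by fun_prop)).inter (isClosed_le (by fun_prop) (by fun_prop))

/-- The order interval `[0, A]` for the order defined by the light cone. -/
def coneInterval (A : Fin 4 → ℝ) : Set (Fin 4 → ℝ) :=
  {J | J ∈ lightCone ∧ A - J ∈ lightCone}

theorem convex_coneInterval (A : Fin 4 → ℝ) : Convex ℝ (coneInterval A) := by
  intro e he f hf a b ha hb hab
  refine ⟨convex_lightCone he.1 hf.1 ha hb hab, ?_⟩
  have h : A - (a • e + b • f) = a • (A - e) + b • (A - f) := by
    ext i
    simp only [Pi.sub_apply, Pi.add_apply, Pi.smul_apply, smul_eq_mul]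
    linear_combination (-A i) * hab
  rw [h]
  exact convex_lightCone he.2 hf.2 ha hb hab

theorem isCompact_coneInterval (A : Fin 4 → ℝ) : IsCompact (coneInterval A) := by
  refine Metric.isCompact_of_isClosed_isBounded
    (isClosed_lightCone.inter (isClosed_lightCone.preimage (by fun_prop))) ?_
  refine (Metric.isBounded_closedBall (x := (0 : Fin 4 → ℝ)) (r := |A 0|)).subset ?_
  intro J hJ
  have hA := hJ.2.1
  simp only [Pi.sub_apply] at hA
  have h0 := hJ.1.1
  have h1 := hJ.1.2
  have hb : J 0 ≤ |A 0| := by linarith [le_abs_self (A 0)]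
  rw [mem_closedBall_zero_iff, pi_norm_le_iff_of_nonneg (abs_nonneg _)]
  intro i
  rw [Real.norm_eq_abs]
  refine le_trans (abs_le_of_sq_le_sq (b := J 0) ?_ h0) hb
  fin_cases i <;> simp <;>
    nlinarith [sq_nonneg (J 1), sq_nonneg (J 2), sq_nonneg (J 3)]

/-- A non-spacelike vector lies in the forward or the backward cone; a positive Lorentz product with
the forward timelike `A` excludes the backward one. -/
theorem mem_lightCone_of_lorentz_nonneg {A J : Fin 4 → ℝ} (hA : 0 ≤ A 0) (hD : 0 < lorentzSq A)
    (hJ : 0 ≤ lorentzSq J)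
    (hAJ : 0 < A 0 * J 0 - A 1 * J 1 - A 2 * J 2 - A 3 * J 3) : J ∈ lightCone := by
  unfold lorentzSq at hD hJ
  refine ⟨?_, by linarith⟩
  by_contra! h
  have := mul_add_mul_add_mul_le (a₁ := -A 1) (a₂ := -A 2) (a₃ := -A 3) (b₁ := J 1) (b₂ := J 2)
    (b₃ := J 3) (M := A 0) (N := -J 0) hA (by linarith) (by nlinarith) (by nlinarith)
  linarith

/-- A lower bound for the maximum of a spacelike functional on an order interval. -/
theorem exists_mem_coneInterval_pair4_ge {A w : Fin 4 → ℝ} (hA : A ∈ lightCone)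
    (hw : lorentzSq w ≤ 0) :
    ∃ J ∈ coneInterval A,
      pair4 w A + √(pair4 w A ^ 2 + -lorentzSq w * lorentzSq A) ≤ 2 * pair4 w J := by
  have hD : 0 ≤ lorentzSq A := by unfold lorentzSq; linarith [hA.2]
  rcases hD.eq_or_lt with hD | hD
  · rw [← hD, mul_zero, add_zero, Real.sqrt_sq_eq_abs]
    rcases le_total 0 (pair4 w A) with h | h
    · refine ⟨A, ⟨hA, by simpa using zero_mem_lightCone⟩, ?_⟩
      rw [abs_of_nonneg h]
      linarith
    · refine ⟨0, ⟨zero_mem_lightCone, by simpa using hA⟩, ?_⟩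
      rw [abs_of_nonpos h]
      simp [pair4]
  set p := pair4 w A with hp
  set D := lorentzSq A with hDdef
  set m := -lorentzSq w with hm
  have hm0 : 0 ≤ m := by linarith
  have hS : 0 ≤ p ^ 2 + m * D := by positivity
  have hS0 := Real.sqrt_nonneg (p ^ 2 + m * D)
  have hSS := Real.sq_sqrt hS
  generalize √(p ^ 2 + m * D) = S at hS0 hSS ⊢
  clear_value p D m
  rcases hS0.eq_or_lt with h0 | hpos
  · have hp0 : p = 0 := by
      have : p ^ 2 ≤ 0 := by nlinarith [mul_nonneg hm0 hD.le]
      nlinarith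
    refine ⟨0, ⟨zero_mem_lightCone, by simpa using hA⟩, ?_⟩
    rw [← h0, hp0]
    simp [pair4]
  -- `ν` is proportional to the Lorentz-orthogonal part of `w`
  let ν : Fin 4 → ℝ := ![(p * A 0 - D * w 0) / S, (p * A 1 + D * w 1) / S,
    (p * A 2 + D * w 2) / S, (p * A 3 + D * w 3) / S]
  have hνA : A 0 * ν 0 - A 1 * ν 1 - A 2 * ν 2 - A 3 * ν 3 = 0 := by
    simp only [ν, Matrix.cons_val]
    field_simp
    rw [hp, hDdef]
    unfold pair4 lorentzSq
    ring
  have hνν : lorentzSq ν = -D := by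
    simp only [lorentzSq, ν, Matrix.cons_val]
    field_simp
    rw [hSS, hp, hm, hDdef]
    unfold pair4 lorentzSq
    ring
  have hwν : pair4 w ν = S := by
    simp only [pair4, ν, Matrix.cons_val]
    field_simp
    rw [hSS, hp, hm, hDdef]
    unfold pair4 lorentzSq
    ring
  clear_value ν
  have hD2 := hDdef
  unfold lorentzSq at hνν hD2
  unfold pair4 at hwν
  -- Since `ν` is Lorentz-orthogonal to `A` with square `-D`, both `A + ν` and `A - ν` are null.
  refine ⟨(1 / 2 : ℝ) • (A + ν), ⟨?_, ?_⟩, ?_⟩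
  · refine mem_lightCone_of_lorentz_nonneg hA.1 (hDdef ▸ hD) ?_ ?_ <;>
      simp only [lorentzSq, Pi.smul_apply, Pi.add_apply, smul_eq_mul] <;> nlinarith
  · refine mem_lightCone_of_lorentz_nonneg hA.1 (hDdef ▸ hD) ?_ ?_ <;>
      simp only [lorentzSq, Pi.smul_apply, Pi.add_apply, Pi.sub_apply, smul_eq_mul] <;> nlinarith
  · simp only [pair4, Pi.smul_apply, Pi.add_apply, smul_eq_mul]
    rw [hp, ← hwν]
    unfold pair4
    linarith

theorem pair4_sub (w e f : Fin 4 → ℝ) : pair4 w (e - f) = pair4 w e - pair4 w f := by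
  simp only [pair4, Pi.sub_apply]
  ring

theorem pair4_add (w e f : Fin 4 → ℝ) : pair4 w (e + f) = pair4 w e + pair4 w f := by
  simp only [pair4, Pi.add_apply]
  ring

theorem pair4_unitCoord (w : Fin 4 → ℝ) : pair4 w unitCoord = w 0 := by
  simp [pair4, unitCoord]

theorem pair4_nonneg {w e : Fin 4 → ℝ} (hw : w ∈ lightCone) (he : e ∈ lightCone) :
    0 ≤ pair4 w e := by
  have := mul_add_mul_add_mul_le (a₁ := -w 1) (a₂ := -w 2) (a₃ := -w 3) hw.1 he.1
    (by linarith [hw.2]) he.2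
  unfold pair4
  linarith

theorem exists_pair4_eq (φ : StrongDual ℝ (Fin 4 → ℝ)) : ∃ w, ∀ e, φ e = pair4 w e := by
  refine ⟨fun i => φ (Pi.single i 1), fun e => ?_⟩
  have he : e = ∑ i, e i • (Pi.single i 1 : Fin 4 → ℝ) := by
    ext j
    simp [Finset.sum_apply, Pi.single_apply]
  conv_lhs => rw [he]
  rw [map_sum, Fin.sum_univ_four]
  simp only [map_smul, smul_eq_mul, pair4]
  ring

open scoped Pointwise in
/-- A criterion for joint measurability of the binary qubit observables with Pauli coordinates `A`
and `B`, where `T₁` and `T₂` bound the determinants of the effects of the first one. -/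
theorem exists_add_eq_of_lorentzSq_ge {A B : Fin 4 → ℝ} {k T₁ T₂ : ℝ}
    (hA : A ∈ coneInterval unitCoord)
    (hB : B ∈ coneInterval unitCoord)
    (hT : T₁ + T₂ = 1)
    (hdet₁ : k ^ 2 * T₁ ^ 2 ≤ lorentzSq A) (hdet₂ : k ^ 2 * T₂ ^ 2 ≤ lorentzSq (unitCoord - A))
    (hsupp : ∀ w, lorentzSq w ≤ 0 →
      2 * pair4 w B ≤ w 0 + √(w 0 ^ 2 + -lorentzSq w * k ^ 2)) :
    ∃ J ∈ coneInterval A, ∃ J' ∈ coneInterval (unitCoord - A), J + J' = B := by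
  by_contra hcon
  have hmem : B ∉ coneInterval A + coneInterval (unitCoord - A) := by
    rwa [Set.mem_add]
  obtain ⟨φ, u, hφ, hu⟩ := geometric_hahn_banach_closed_point
    ((convex_coneInterval A).add (convex_coneInterval (unitCoord - A)))
    ((isCompact_coneInterval A).add (isCompact_coneInterval (unitCoord - A))).isClosed hmem
  obtain ⟨w, hw⟩ := exists_pair4_eq φ
  have key : ∀ J ∈ coneInterval A, ∀ J' ∈ coneInterval (unitCoord - A),
      pair4 w J + pair4 w J' < pair4 w B := by
    intro J hJ J' hJ'
    rw [← pair4_add, ← hw, ← hw]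
    exact (hφ _ (Set.add_mem_add hJ hJ')).trans hu
  have hz : ∀ {C : Fin 4 → ℝ}, C ∈ lightCone → (0 : Fin 4 → ℝ) ∈ coneInterval C := fun hC =>
    ⟨zero_mem_lightCone, by simpa using hC⟩
  have ho : ∀ {C : Fin 4 → ℝ}, C ∈ lightCone → C ∈ coneInterval C := fun hC =>
    ⟨hC, by simpa using zero_mem_lightCone⟩
  -- For timelike `w`, the cone is self-dual, so `w` is extremal on `[0, 1]` at an endpoint: the
  -- choice `J = A`, `J' = 1 - A` or `J = J' = 0` contradicts separation.
  rcases lt_or_ge 0 (lorentzSq w) with hpos | hneg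
  · unfold lorentzSq at hpos
    rcases le_total 0 (w 0) with h0 | h0
    · have h1 := key _ (ho hA.1) _ (ho hA.2)
      have h2 := pair4_nonneg (w := w) ⟨h0, by linarith⟩ hB.2
      rw [pair4_sub] at h1 h2
      linarith
    · have h1 := key _ (hz hA.1) _ (hz hA.2)
      have h2 := pair4_nonneg (w := -w) ⟨by simpa using h0, by simp; linarith⟩ hB.1
      simp only [pair4, Pi.neg_apply, Pi.zero_apply] at h1 h2
      linarith
  · obtain ⟨J, hJ, hJw⟩ := exists_mem_coneInterval_pair4_ge hA.1 hneg
    obtain ⟨J', hJ', hJw'⟩ := exists_mem_coneInterval_pair4_ge hA.2 hneg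
    have h1 := key J hJ J' hJ'
    have h2 := hsupp w hneg
    rw [pair4_sub, pair4_unitCoord] at hJw'
    set p := pair4 w A
    set m := -lorentzSq w with hm
    have hm0 : 0 ≤ m := by linarith
    have hsq : √m ^ 2 = m := Real.sq_sqrt hm0
    have e1 : √(p ^ 2 + (√m * (k * T₁)) ^ 2) ≤ √(p ^ 2 + m * lorentzSq A) := by
      apply Real.sqrt_le_sqrt
      rw [mul_pow, hsq, mul_pow]
      gcongr
    have e2 : √((w 0 - p) ^ 2 + (√m * (k * T₂)) ^ 2) ≤
        √((w 0 - p) ^ 2 + m * lorentzSq (unitCoord - A)) := by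
      apply Real.sqrt_le_sqrt
      rw [mul_pow, hsq, mul_pow]
      gcongr
    -- Triangle inequality for two plane vectors whose sum is `(w 0, √m * k)`, because `T₁ + T₂ =
    -- 1`.
    have e3 : √(w 0 ^ 2 + m * k ^ 2) ≤
        √(p ^ 2 + (√m * (k * T₁)) ^ 2) + √((w 0 - p) ^ 2 + (√m * (k * T₂)) ^ 2) := by
      have := norm_add_le (⟨p, √m * (k * T₁)⟩ : ℂ) ⟨w 0 - p, √m * (k * T₂)⟩
      rw [Complex.norm_eq_sqrt_sq_add_sq, Complex.norm_eq_sqrt_sq_add_sq,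
        Complex.norm_eq_sqrt_sq_add_sq] at this
      convert this using 2
      simp only [Complex.add_re, Complex.add_im]
      rw [add_sub_cancel, ← mul_add, ← mul_add, hT, mul_one, mul_pow, hsq]
    linarith

end

/-! ### Estimates for the induced effects. -/

theorem inducedCoord_unitCoord {c s : ℝ} (h : c ^ 2 + s ^ 2 = 1) (r : Fin 4 → ℝ) :
    inducedCoord c s r unitCoord = unitCoord := by
  ext i
  fin_cases i <;> simp [inducedCoord, unitCoord, h]

theorem inducedCoord_sub (c s : ℝ) (r f g : Fin 4 → ℝ) :
    inducedCoord c s r (f - g) = inducedCoord c s r f - inducedCoord c s r g := by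
  ext i
  fin_cases i <;> simp [inducedCoord] <;> ring

/-- The difference of the two sides is a nonnegative combination of the determinants of `f` and `r`.
-/
theorem lorentzSq_inducedCoord_ge {c s : ℝ} (h : c ^ 2 + s ^ 2 = 1) {r f : Fin 4 → ℝ}
    (hr : r ∈ lightCone) (hr0 : r 0 = 1 / 2) (hf : f ∈ lightCone) :
    c ^ 2 * (2 * pair4 f r) ^ 2 ≤ lorentzSq (inducedCoord c s r f) := by
  have h1 : lorentzSq (inducedCoord c s r f) = c ^ 2 * (2 * pair4 f r) ^ 2
      + s ^ 2 * (f 0 ^ 2 - (f 1 ^ 2 + f 2 ^ 2 + f 3 ^ 2))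
      + 4 * ((c * s) ^ 2 * (f 1 ^ 2 + f 2 ^ 2 + f 3 ^ 2)
        * (r 0 ^ 2 - (r 1 ^ 2 + r 2 ^ 2 + r 3 ^ 2))) := by
    simp only [lorentzSq, inducedCoord, pair4, hr0, Matrix.cons_val]
    linear_combination (c ^ 2 * (f 0 + 2 * (f 1 * r 1 + f 2 * r 2 + f 3 * r 3)) ^ 2
      + s ^ 2 * f 0 ^ 2 - s ^ 2 * (f 1 ^ 2 + f 2 ^ 2 + f 3 ^ 2)) * h
  have h2 : 0 ≤ s ^ 2 * (f 0 ^ 2 - (f 1 ^ 2 + f 2 ^ 2 + f 3 ^ 2)) :=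
    mul_nonneg (sq_nonneg s) (sub_nonneg.2 hf.2)
  have h3 : 0 ≤ (c * s) ^ 2 * (f 1 ^ 2 + f 2 ^ 2 + f 3 ^ 2)
        * (r 0 ^ 2 - (r 1 ^ 2 + r 2 ^ 2 + r 3 ^ 2)) :=
    mul_nonneg (by positivity) (sub_nonneg.2 hr.2)
  linarith

theorem inducedCoord_mem_lightCone {c s : ℝ} (h : c ^ 2 + s ^ 2 = 1) {r f : Fin 4 → ℝ}
    (hr : r ∈ lightCone) (hr0 : r 0 = 1 / 2) (hf : f ∈ lightCone) :
    inducedCoord c s r f ∈ lightCone := by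
  have h1 := lorentzSq_inducedCoord_ge h hr hr0 hf
  have h2 := pair4_nonneg hf hr
  have h3 : inducedCoord c s r f 0 = c ^ 2 * (2 * pair4 f r) + s ^ 2 * f 0 := by
    simp only [inducedCoord, pair4, hr0, Matrix.cons_val]
    ring
  refine ⟨?_, ?_⟩
  · rw [h3]
    have := hf.1
    positivity
  · have : 0 ≤ c ^ 2 * (2 * pair4 f r) ^ 2 := by positivity
    unfold lorentzSq at h1
    linarith

theorem inducedCoord_mem_coneInterval {c s : ℝ} (h : c ^ 2 + s ^ 2 = 1) {r f : Fin 4 → ℝ}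
    (hr : r ∈ lightCone) (hr0 : r 0 = 1 / 2) (hf : f ∈ coneInterval unitCoord) :
    inducedCoord c s r f ∈ coneInterval unitCoord := by
  refine ⟨inducedCoord_mem_lightCone h hr hr0 hf.1, ?_⟩
  have := inducedCoord_mem_lightCone h hr hr0 hf.2
  rwa [inducedCoord_sub, inducedCoord_unitCoord h] at this

theorem two_mul_pair4_inducedCoord_le {c s : ℝ} (h : c ^ 2 + s ^ 2 = 1) {r f : Fin 4 → ℝ}
    (hr : r ∈ lightCone) (hr0 : r 0 = 1 / 2) (hf : f ∈ coneInterval unitCoord)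
    {w : Fin 4 → ℝ} (hw : lorentzSq w ≤ 0) :
    2 * pair4 w (inducedCoord c s r f) ≤ w 0 + √(w 0 ^ 2 + -lorentzSq w * s ^ 2) := by
  have hX : 0 ≤ w 0 ^ 2 + -lorentzSq w * s ^ 2 :=
    add_nonneg (sq_nonneg _) (mul_nonneg (by linarith) (sq_nonneg _))
  have hR0 := Real.sqrt_nonneg (w 0 ^ 2 + -lorentzSq w * s ^ 2)
  have hRR := Real.sq_sqrt hX
  generalize √(w 0 ^ 2 + -lorentzSq w * s ^ 2) = R at hR0 hRR ⊢
  obtain ⟨hw1, hw2⟩ := abs_le_of_sq_le_sq' (a := w 0) (b := R)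
    (by rw [hRR]; linarith [mul_nonneg (neg_nonneg.2 hw) (sq_nonneg s)]) hR0
  -- `V` collects the coefficients of the spatial part of `f`, turning the pairing into `w 0 * f 0 +
  -- f · V`.
  let V₁ := 2 * c ^ 2 * w 0 * r 1 + s ^ 2 * w 1 - 2 * c * s * (w 2 * r 3 - w 3 * r 2)
  let V₂ := 2 * c ^ 2 * w 0 * r 2 + s ^ 2 * w 2 - 2 * c * s * (w 3 * r 1 - w 1 * r 3)
  let V₃ := 2 * c ^ 2 * w 0 * r 3 + s ^ 2 * w 3 - 2 * c * s * (w 1 * r 2 - w 2 * r 1)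
  have hpair : 2 * pair4 w (inducedCoord c s r f) =
      2 * w 0 * f 0 + 2 * (f 1 * V₁ + f 2 * V₂ + f 3 * V₃) := by
    simp only [pair4, inducedCoord, Matrix.cons_val, V₁, V₂, V₃]
    linear_combination 2 * w 0 * f 0 * h
  have hV : V₁ ^ 2 + V₂ ^ 2 + V₃ ^ 2 ≤ R ^ 2 := by
    have e : R ^ 2 - (V₁ ^ 2 + V₂ ^ 2 + V₃ ^ 2) =
        4 * (c ^ 4 * w 0 ^ 2 + (c * s) ^ 2 * (w 1 ^ 2 + w 2 ^ 2 + w 3 ^ 2))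
          * (r 0 ^ 2 - (r 1 ^ 2 + r 2 ^ 2 + r 3 ^ 2))
        + (c * s) ^ 2 * (w 0 - 2 * (w 1 * r 1 + w 2 * r 2 + w 3 * r 3)) ^ 2 := by
      rw [hRR, hr0]
      simp only [lorentzSq, V₁, V₂, V₃]
      linear_combination (-(c ^ 2 * w 0 ^ 2) - s ^ 2 * (w 1 ^ 2 + w 2 ^ 2 + w 3 ^ 2) - w 0 ^ 2) * h
    have h1 := mul_nonneg (show 0 ≤ 4 * (c ^ 4 * w 0 ^ 2 +
      (c * s) ^ 2 * (w 1 ^ 2 + w 2 ^ 2 + w 3 ^ 2)) by positivity) (sub_nonneg.2 hr.2)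
    have h2 : 0 ≤ (c * s) ^ 2 * (w 0 - 2 * (w 1 * r 1 + w 2 * r 2 + w 3 * r 3)) ^ 2 := by
      positivity
    linarith
  rw [hpair]
  obtain ⟨hf1, hf2⟩ := hf.1
  obtain ⟨hg1, hg2⟩ := hf.2
  simp only [unitCoord, Pi.sub_apply, Matrix.cons_val] at hg1 hg2
  -- The spatial part of `f` has length at most `min (f 0) (1 - f 0)`; with `|w 0| ≤ R` the bound is
  -- tightest at `f 0 = 1 / 2`.
  rcases le_total (f 0) (1 / 2) with hle | hle
  · have := mul_add_mul_add_mul_le hf1 hR0 hf2 hV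
    nlinarith
  · have := mul_add_mul_add_mul_le (a₁ := f 1) (a₂ := f 2) (a₃ := f 3) hg1 hR0
      (by linarith) hV
    nlinarith

/-! ### Joint measurability of the assemblage. -/

theorem IsDensityMatrix.exists_pauliMatrix {ρ : Matrix (Fin 2) (Fin 2) ℂ}
    (h : IsDensityMatrix ρ) : ∃ r ∈ lightCone, r 0 = 1 / 2 ∧ ρ = pauliMatrix r := by
  obtain ⟨r, rfl⟩ := _root_.exists_pauliMatrix h.1.isHermitian
  refine ⟨r, (pauliMatrix_posSemidef_iff r).1 h.1, ?_, rfl⟩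
  have := congrArg Complex.re h.2
  simp [pauliMatrix, Matrix.trace_fin_two] at this
  linarith

theorem isDensityMatrix_pauliMatrix {r : Fin 4 → ℝ} (hr : r ∈ lightCone) (hr0 : r 0 = 1 / 2) :
    IsDensityMatrix (pauliMatrix r) := by
  refine ⟨(pauliMatrix_posSemidef_iff r).2 hr, ?_⟩
  norm_num [pauliMatrix, Matrix.trace_fin_two, hr0]

theorem IsPOVM.exists_pauliMatrix {F : Fin 2 → Matrix (Fin 2) (Fin 2) ℂ} (h : IsPOVM F) :
    ∃ f ∈ coneInterval unitCoord, F 0 = pauliMatrix f ∧ F 1 = pauliMatrix (unitCoord - f) := by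
  obtain ⟨f, hf⟩ := _root_.exists_pauliMatrix (h.1 0).isHermitian
  have h1 : F 1 = pauliMatrix (unitCoord - f) := by
    rw [pauliMatrix_sub, pauliMatrix_unitCoord, ← h.2, Fin.sum_univ_two, ← hf, add_sub_cancel_left]
  exact ⟨f, ⟨(pauliMatrix_posSemidef_iff _).1 (hf ▸ h.1 0),
    (pauliMatrix_posSemidef_iff _).1 (h1 ▸ h.1 1)⟩, hf, h1⟩

theorem isPOVM_pauliMatrix {f : Fin 4 → ℝ} (hf : f ∈ coneInterval unitCoord)
    {F : Fin 2 → Matrix (Fin 2) (Fin 2) ℂ} (h0 : F 0 = pauliMatrix f)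
    (h1 : F 1 = pauliMatrix (unitCoord - f)) : IsPOVM F := by
  refine ⟨fun b => ?_, ?_⟩
  · fin_cases b
    · exact h0 ▸ (pauliMatrix_posSemidef_iff _).2 hf.1
    · exact h1 ▸ (pauliMatrix_posSemidef_iff _).2 hf.2
  · rw [Fin.sum_univ_two, h0, h1, ← pauliMatrix_add, add_sub_cancel, pauliMatrix_unitCoord]

theorem isJointlyMeasurable_of_add_eq {G : Fin 2 → Fin 2 → Matrix (Fin 2) (Fin 2) ℂ}
    {A B J J' : Fin 4 → ℝ} (hJ : J ∈ coneInterval A) (hJ' : J' ∈ coneInterval (unitCoord - A))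
    (hB : J + J' = B) (h00 : G 0 0 = pauliMatrix A) (h01 : G 0 1 = pauliMatrix (unitCoord - A))
    (h10 : G 1 0 = pauliMatrix B) (h11 : G 1 1 = pauliMatrix (unitCoord - B)) :
    IsJointlyMeasurable G := by
  -- The four effects of the parent POVM carry the outcome pairs `(0,0)`, `(0,1)`, `(1,0)`, `(1,1)`.
  refine ⟨4, ![pauliMatrix J, pauliMatrix (A - J), pauliMatrix J',
    pauliMatrix (unitCoord - A - J')],
    ![![![1, 0], ![1, 0], ![0, 1], ![0, 1]], ![![1, 0], ![0, 1], ![1, 0], ![0, 1]]],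
    ⟨fun l => ?_, ?_⟩, ⟨fun a l b => ?_, fun a l => ?_⟩, fun a b => ?_⟩
  · fin_cases l <;> refine (pauliMatrix_posSemidef_iff _).2 ?_
    exacts [hJ.1, hJ.2, hJ'.1, hJ'.2]
  · simp only [Fin.sum_univ_four, Matrix.cons_val, ← pauliMatrix_add, ← pauliMatrix_unitCoord]
    congr 1
    abel
  · fin_cases a <;> fin_cases l <;> fin_cases b <;> simp
  · fin_cases a <;> fin_cases l <;> simp
  · subst hB
    fin_cases a <;> fin_cases b <;> simp [Fin.sum_univ_four, h00, h01, h10, h11,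
      ← pauliMatrix_add]
    congr 1
    abel

theorem isJointlyMeasurable_partialSwap {α : ℝ} (hα : 1 / 2 ≤ Real.cos (α / 2) ^ 2)
    {ρ F : Fin 2 → Matrix (Fin 2) (Fin 2) ℂ} (hρ : ∀ a, IsDensityMatrix (ρ a)) (hF : IsPOVM F) :
    IsJointlyMeasurable (inducedAssemblage (partialSwap α) ρ F) := by
  obtain ⟨r, hr, hr0, hρr⟩ := (hρ 0).exists_pauliMatrix
  obtain ⟨q, hq, hq0, hρq⟩ := (hρ 1).exists_pauliMatrix
  obtain ⟨f, hf, hF0, hF1⟩ := hF.exists_pauliMatrix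
  have h : Real.cos (α / 2) ^ 2 + Real.sin (α / 2) ^ 2 = 1 := Real.cos_sq_add_sin_sq _
  have hsub : ∀ x : Fin 4 → ℝ, unitCoord - inducedCoord (Real.cos (α / 2)) (Real.sin (α / 2)) x f
      = inducedCoord (Real.cos (α / 2)) (Real.sin (α / 2)) x (unitCoord - f) := fun x => by
    rw [inducedCoord_sub, inducedCoord_unitCoord h]
  obtain ⟨J, hJ, J', hJ', hJJ⟩ := exists_add_eq_of_lorentzSq_ge (k := Real.cos (α / 2))
    (T₁ := 2 * pair4 f r) (T₂ := 2 * pair4 (unitCoord - f) r)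
    (inducedCoord_mem_coneInterval h hr hr0 hf) (inducedCoord_mem_coneInterval h hq hq0 hf)
    (by simp [pair4, unitCoord, hr0]; ring) (lorentzSq_inducedCoord_ge h hr hr0 hf.1)
    (by rw [hsub]; exact lorentzSq_inducedCoord_ge h hr hr0 hf.2) fun w hw => by
      refine (two_mul_pair4_inducedCoord_le h hq hq0 hf hw).trans ?_
      have : Real.sin (α / 2) ^ 2 ≤ Real.cos (α / 2) ^ 2 := by linarith
      have hw' : 0 ≤ -lorentzSq w := by linarith
      gcongr
  refine isJointlyMeasurable_of_add_eq hJ hJ' hJJ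
    (inducedAssemblage_eq_pauliMatrix α hρr hr0 hF0) ?_
    (inducedAssemblage_eq_pauliMatrix α hρq hq0 hF0) ?_
  · rw [hsub]
    exact inducedAssemblage_eq_pauliMatrix α hρr hr0 hF1
  · rw [hsub]
    exact inducedAssemblage_eq_pauliMatrix α hρq hq0 hF1

theorem isJointlyMeasurable_of_forall_eq {x o d : Type*} [Fintype o] [Fintype d] [DecidableEq d]
    {G : x → o → Matrix d d ℂ} {F : o → Matrix d d ℂ} (hF : IsPOVM F) (h : ∀ a b, G a b = F b) :
    IsJointlyMeasurable G := by
  classical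
  let e := Fintype.equivFin o
  refine ⟨Fintype.card o, F ∘ e.symm, fun _ l b => if e.symm l = b then 1 else 0,
    ⟨fun l => hF.1 _, ?_⟩, ⟨fun a l b => ?_, fun a l => ?_⟩, fun a b => ?_⟩
  · rw [← hF.2]
    exact e.symm.sum_comp F
  · positivity
  · simp
  · rw [h]
    refine Eq.trans ?_ (e.symm.sum_comp fun b' => (((if b' = b then 1 else 0 : ℝ) : ℂ)) • F b').symm
    simp

theorem isPOVMAssemblage_partialSwap (α : ℝ) {x : Type*} {ρ : x → Matrix (Fin 2) (Fin 2) ℂ}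
    {F : Fin 2 → Matrix (Fin 2) (Fin 2) ℂ} (hρ : ∀ a, IsDensityMatrix (ρ a)) (hF : IsPOVM F) :
    IsPOVMAssemblage (inducedAssemblage (partialSwap α) ρ F) := by
  intro a
  obtain ⟨r, hr, hr0, hρr⟩ := (hρ a).exists_pauliMatrix
  obtain ⟨f, hf, hF0, hF1⟩ := hF.exists_pauliMatrix
  have h : Real.cos (α / 2) ^ 2 + Real.sin (α / 2) ^ 2 = 1 := Real.cos_sq_add_sin_sq _
  refine isPOVM_pauliMatrix (inducedCoord_mem_coneInterval h hr hr0 hf)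
    (inducedAssemblage_eq_pauliMatrix α hρr hr0 hF0) ?_
  rw [inducedAssemblage_eq_pauliMatrix α hρr hr0 hF1, inducedCoord_sub, inducedCoord_unitCoord h]

/-! ### Incompatibility for `π/2 < α < π`. -/

theorem pauliMatrix_sum_smul {k : ℕ} (p : Fin k → ℝ) (e : Fin k → Fin 4 → ℝ) :
    ∑ l, ((p l : ℝ) : ℂ) • pauliMatrix (e l) = pauliMatrix (∑ l, p l • e l) := by
  ext i j
  fin_cases i <;> fin_cases j <;>
    simp [pauliMatrix, Matrix.sum_apply, Finset.mul_sum, ← Finset.sum_add_distrib,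
      ← Finset.sum_sub_distrib] <;>
    exact Finset.sum_congr rfl fun _ _ => by ring

/-- A necessary condition for the joint measurability of two binary qubit observables. -/
theorem IsJointlyMeasurable.pauli_le {G : Fin 2 → Fin 2 → Matrix (Fin 2) (Fin 2) ℂ}
    (hG : IsJointlyMeasurable G) {A B : Fin 4 → ℝ} (hA : G 0 0 = pauliMatrix A)
    (hB : G 1 0 = pauliMatrix B) : A 3 + B 3 + (A 2 - B 2) ≤ 1 := by
  obtain ⟨k, H, h, ⟨hH, hH1⟩, ⟨hh0, hh1⟩, hGh⟩ := hG
  choose e he using fun l => exists_pauliMatrix (hH l).isHermitian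
  have hcone : ∀ l, e l ∈ lightCone := fun l =>
    (pauliMatrix_posSemidef_iff _).1 (he l ▸ hH l)
  have coord : ∀ a C, G a 0 = pauliMatrix C → C = ∑ l, h a l 0 • e l := fun a C hC => by
    apply pauliMatrix_injective
    rw [← hC, hGh, ← pauliMatrix_sum_smul]
    simp only [he]
  have hone : unitCoord = ∑ l, (1 : ℝ) • e l := by
    apply pauliMatrix_injective
    rw [pauliMatrix_unitCoord, ← hH1, ← pauliMatrix_sum_smul]
    simp [he]
  have h0 : ∑ l, e l 0 = 1 := by
    have := congrFun hone 0
    simpa [unitCoord] using this.symm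
  have h3 : ∑ l, e l 3 = 0 := by
    have := congrFun hone 3
    simpa [unitCoord] using this.symm
  have key : ∀ l, h 0 l 0 * e l 3 + h 1 l 0 * e l 3 + (h 0 l 0 * e l 2 - h 1 l 0 * e l 2)
      - e l 3 ≤ e l 0 := by
    intro l
    have b : ∀ a, 0 ≤ h a l 0 ∧ h a l 0 ≤ 1 := fun a => by
      have := hh1 a l
      rw [Fin.sum_univ_two] at this
      exact ⟨hh0 a l 0, by linarith [hh0 a l 1]⟩
    obtain ⟨p0, p1⟩ := b 0
    obtain ⟨q0, q1⟩ := b 1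
    obtain ⟨c0, c1⟩ := hcone l
    obtain ⟨y1, y2⟩ := abs_le_of_sq_le_sq' (a := e l 2) (b := e l 0) (by nlinarith) c0
    obtain ⟨z1, z2⟩ := abs_le_of_sq_le_sq' (a := e l 3) (b := e l 0) (by nlinarith) c0
    generalize h 0 l 0 = p at *
    generalize h 1 l 0 = q at *
    -- The left side is `(p + q - 1) * e l 3 + (p - q) * e l 2`, and `|p + q - 1| + |p - q| ≤ 1` on
    -- the unit square.
    rcases le_total p q with hpq | hpq <;> rcases le_total (p + q) 1 with hs | hs <;> nlinarith
  have hsum := Finset.sum_le_sum fun l (_ : l ∈ Finset.univ) => key l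
  rw [coord 0 A hA, coord 1 B hB]
  simp only [Finset.sum_sub_distrib, Finset.sum_add_distrib, h0, h3] at hsum
  simp only [Finset.sum_apply, Pi.smul_apply, smul_eq_mul]
  linarith

theorem exists_isIncompatible_partialSwap {α : ℝ} (h1 : Real.pi / 2 < α) (h2 : α < Real.pi) :
    ∃ (ρ : Fin 2 → Matrix (Fin 2) (Fin 2) ℂ) (F : Fin 2 → Matrix (Fin 2) (Fin 2) ℂ),
      (∀ a, IsDensityMatrix (ρ a)) ∧ IsPOVM F ∧
        IsIncompatible (inducedAssemblage (partialSwap α) ρ F) := by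
  -- The states are the eigenstates of `σ_x` and the measurement is that of `σ_z`; the commutator
  -- terms then point along `±σ_y`.
  let r : Fin 2 → Fin 4 → ℝ := ![![1 / 2, 1 / 2, 0, 0], ![1 / 2, -1 / 2, 0, 0]]
  let f : Fin 4 → ℝ := ![1 / 2, 0, 0, 1 / 2]
  have hr0 : ∀ a, r a 0 = 1 / 2 := fun a => by fin_cases a <;> rfl
  have hρ : ∀ a, IsDensityMatrix (pauliMatrix (r a)) := fun a =>
    isDensityMatrix_pauliMatrix (by fin_cases a <;> simp [r, lightCone] <;> norm_num) (hr0 a)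
  have hF : IsPOVM ![pauliMatrix f, pauliMatrix (unitCoord - f)] :=
    isPOVM_pauliMatrix (by simp [coneInterval, lightCone, f, unitCoord]; norm_num) rfl rfl
  refine ⟨fun a => pauliMatrix (r a), _, hρ, hF, isPOVMAssemblage_partialSwap α hρ hF, fun hJ => ?_⟩
  have hle := hJ.pauli_le (inducedAssemblage_eq_pauliMatrix α rfl (hr0 0) rfl)
    (inducedAssemblage_eq_pauliMatrix α rfl (hr0 1) rfl)
  have hpi := Real.pi_pos
  have hc : 0 < Real.cos (α / 2) := Real.cos_pos_of_mem_Ioo ⟨by linarith, by linarith⟩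
  have hs : Real.cos (α / 2) < Real.sin (α / 2) := by
    rw [← Real.sin_pi_div_two_sub]
    exact Real.sin_lt_sin_of_lt_of_le_pi_div_two (by linarith) (by linarith) (by linarith)
  have h := Real.cos_sq_add_sin_sq (α / 2)
  -- The left side of `hle` equals `s² + c s`, which exceeds `s² + c² = 1` because `0 < c < s`.
  simp [inducedCoord, r, f] at hle
  nlinarith

theorem proposition3 :
    (∀ α : ℝ, (0 ≤ α ∧ α ≤ Real.pi / 2) ∨ α = Real.pi →
      ∀ (ρ : Fin 2 → Matrix (Fin 2) (Fin 2) ℂ) (F : Fin 2 → Matrix (Fin 2) (Fin 2) ℂ),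
        (∀ a, IsDensityMatrix (ρ a)) → IsPOVM F →
          IsJointlyMeasurable (inducedAssemblage (partialSwap α) ρ F)) ∧
    (∀ α : ℝ, Real.pi / 2 < α → α < Real.pi →
      ∃ (ρ : Fin 2 → Matrix (Fin 2) (Fin 2) ℂ) (F : Fin 2 → Matrix (Fin 2) (Fin 2) ℂ),
        (∀ a, IsDensityMatrix (ρ a)) ∧ IsPOVM F ∧
          IsIncompatible (inducedAssemblage (partialSwap α) ρ F)) := by
  refine ⟨?_, fun α h1 h2 => exists_isIncompatible_partialSwap h1 h2⟩
  rintro α (⟨h0, h1⟩ | rfl) ρ F hρ hF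
  · refine isJointlyMeasurable_partialSwap ?_ hρ hF
    have h2 : 0 ≤ Real.cos α := Real.cos_nonneg_of_mem_Icc ⟨by linarith [Real.pi_pos], h1⟩
    rw [Real.cos_sq, mul_div_cancel₀ _ two_ne_zero]
    linarith
  -- At `α = π` the gate is a full swap up to phase, so each induced effect is `F b` itself.
  · refine isJointlyMeasurable_of_forall_eq hF fun a b => ?_
    rw [inducedAssemblage_partialSwap, (hρ a).2]
    simp
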